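/- \textbf{Theorem (Cyclic Kaplansky Theorem).} Let $\mathbb{F}$ be a field and $n\ge 1$ an integer. A linear representation of the cyclic quiver $\mathcal{C}_n$ is a family $u=(U_k,u_k)_{k\in\mathbb{Z}/n}$ where each $U_k$ is an $\mathbb{F}$-vector space and each $u_k:U_k\to U_{k+1}$ is a linear map. An isomorphism from $u$ to $v=(V_k,v_k)_{k\in\mathbb{Z}/n}$ is a family of linear isomorphisms $\varphi_k:U_k\to V_k$ such that $v_k\circ\varphi_k=\varphi_{k+1}\circ u_k$ for all $k$. The dimension of $u$ is $\sum_{k}\dim U_k$. The representation $u$ is locally nilpotent if for every $x\in U_0$ there is an integer $i\ge 0$ such that $(u_{n-1}\circ\cdots\circ u_1\circ u_0)^i(x)=0$. For $k\in\mathbb{Z}/n$ and every ordinal $\alpha$, define subspaces $U_{k,\alpha}\subseteq U_k$ by transfinite recursion: $U_{k,0}=U_k$; $U_{k,\alpha+1}=u_{k-1}(U_{k-1,\alpha})$; and $U_{k,\alpha}=\bigcap_{\beta<\alpha}U_{k,\beta}$ if $\alpha$ is a limit ordinal. The representation $u$ is reduced if $\bigcap_\alpha U_{k,\alpha}=\{0\}$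 for all $k\in\mathbb{Z}/n$. The Kaplansky invariant $\kappa_{k,\alpha}(u)$ is the dimension (a cardinal) of the kernel of the linear map $U_{k,\alpha}/U_{k,\alpha+1}\to U_{k+1,\alpha+1}/U_{k+1,\alpha+2}$ induced by $u_k$. Let $u$ and $v$ be reduced locally nilpotent linear representations of $\mathcal{C}_n$ over $\mathbb{F}$ whose dimensions are countable (finite or countably infinite). Then $u$ and $v$ are isomorphic if and only if $\kappa_{k,\alpha}(u)=\kappa_{k,\alpha}(v)$ for all $k\in\mathbb{Z}/n$ and all countable ordinals $\alpha$ (that is, all $\alpha<\omega_1$). -/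

import Mathlib

open scoped Ordinal Cardinal

universe u w

/-- A linear representation over the field `F` of the cyclic quiver with vertex set `ZMod n`
and exactly one arrow `k ⟶ k + 1` for each vertex `k`: a family of vector spaces
`(U k)` together with linear maps `U k → U (k + 1)`. -/
structure CyclicRep (F : Type w) [Field F] (n : ℕ) where
  U : ZMod n → Type u
  [addCommGroup : ∀ k, AddCommGroup (U k)]
  [module : ∀ k, Module F (U k)]
  map : ∀ k, U k →ₗ[F] U (k + 1)

namespace CyclicRep

attribute [instance] CyclicRep.addCommGroup CyclicRep.module

variable {F : Type w} [Field F] {n : ℕ}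

/-- An isomorphism of representations: linear isomorphisms `φ k : U k ≃ V k` such that
`v k ∘ φ k = φ (k + 1) ∘ u k` for all `k`. -/
structure Iso (u v : CyclicRep.{u, w} F n) where
  φ : ∀ k, u.U k ≃ₗ[F] v.U k
  comm : ∀ k (x : u.U k), v.map k (φ k x) = φ (k + 1) (u.map k x)

/-- The map `u a : U a → U (a + 1)`, where the target vertex `a + 1` may be given by any
expression `b` that equals it. -/
def arrow (u : CyclicRep.{u, w} F n) : ∀ {a b : ZMod n}, a + 1 = b → (u.U a →ₗ[F] u.U b)
  | a, _, rfl => u.map a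

/-- The composite `u (a + m - 1) ∘ ⋯ ∘ u (a + 1) ∘ u a` of `m` consecutive maps, from `U a`
to `U b`, where `b = a + m`. -/
def path (u : CyclicRep.{u, w} F n) :
    ∀ (m : ℕ) {a b : ZMod n}, a + (m : ZMod n) = b → (u.U a →ₗ[F] u.U b)
  | 0, a, b, h =>
      have e : a = b := by simpa using h
      e ▸ LinearMap.id
  | m + 1, a, _, h =>
      (u.arrow (a := a + (m : ZMod n)) (by rw [← h]; push_cast; ring)).comp (u.path m rfl)

/-- The endomorphism `u (k + n - 1) ∘ ⋯ ∘ u (k + 1) ∘ u k` of `U k`. -/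
def cycle (u : CyclicRep.{u, w} F n) (k : ZMod n) : Module.End F (u.U k) :=
  u.path n (by simp)

/-- `u` is locally nilpotent: so is the composite of the cycle at the vertex `0`. -/
def LocallyNilpotent (u : CyclicRep.{u, w} F n) : Prop :=
  ∀ x : u.U 0, ∃ i : ℕ, (u.cycle 0 ^ i) x = 0

/-- The dimension of a representation: the sum of the dimensions of its spaces. -/
noncomputable def dim (u : CyclicRep.{u, w} F n) : Cardinal.{u} :=
  Cardinal.sum fun k => Module.rank F (u.U k)

/-- The transfinite chain of subspaces `U_{k,α}` of `U k`: `U_{k,0} = U k`,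
`U_{k,α+1} = u (k-1) (U_{k-1,α})`, and `U_{k,α} = ⋂ β < α, U_{k,β}` for limit `α`. -/
noncomputable def chain (u : CyclicRep.{u, w} F n) (α : Ordinal.{u}) :
    ∀ k, Submodule F (u.U k) :=
  Ordinal.limitRecOn α
    (fun _ => ⊤)
    (fun _ ih k => (ih (k - 1)).map (u.arrow (sub_add_cancel k 1)))
    (fun α _ ih k => ⨅ (β : Ordinal.{u}) (h : β < α), ih β h k)

theorem chain_zero (u : CyclicRep.{u, w} F n) (k : ZMod n) : u.chain 0 k = ⊤ := by
  simp [chain]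

theorem chain_add_one (u : CyclicRep.{u, w} F n) (α : Ordinal.{u}) (k : ZMod n) :
    u.chain (α + 1) (k + 1) = (u.chain α k).map (u.map k) := by
  have key : ∀ (j b : ZMod n) (h : j + 1 = b), j = b - 1 →
      u.chain (α + 1) b = (u.chain α j).map (u.arrow h) := by
    rintro j b h rfl
    simp only [chain, Ordinal.limitRecOn_add_one]
  exact key k (k + 1) rfl (by simp)

theorem chain_limit (u : CyclicRep.{u, w} F n) {α : Ordinal.{u}} (hα : Order.IsSuccLimit α)
    (k : ZMod n) : u.chain α k = ⨅ (β : Ordinal.{u}) (_ : β < α), u.chain β k := by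
  simp only [chain, Ordinal.limitRecOn_limit _ _ _ _ hα]

theorem map_mem_chain (u : CyclicRep.{u, w} F n) (α : Ordinal.{u}) (k : ZMod n) :
    ∀ x ∈ u.chain α k, u.map k x ∈ u.chain (α + 1) (k + 1) := by
  intro x hx
  rw [chain_add_one]
  exact Submodule.mem_map_of_mem hx

/-- `u` is reduced: for every `k`, the intersection of all the `U_{k,α}` is zero. -/
def Reduced (u : CyclicRep.{u, w} F n) : Prop :=
  ∀ k, ⨅ α : Ordinal.{u}, u.chain α k = ⊥

/-- The quotient space `U_{k,α} / U_{k,α+1}`. -/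
abbrev Layer (u : CyclicRep.{u, w} F n) (k : ZMod n) (α : Ordinal.{u}) : Type u :=
  ↥(u.chain α k) ⧸ (u.chain (α + 1) k).submoduleOf (u.chain α k)

/-- The linear map `U_{k,α} / U_{k,α+1} → U_{k+1,α+1} / U_{k+1,α+2}` induced by `u k`. -/
noncomputable def layerMap (u : CyclicRep.{u, w} F n) (k : ZMod n) (α : Ordinal.{u}) :
    u.Layer k α →ₗ[F] u.Layer (k + 1) (α + 1) :=
  Submodule.mapQ _ _ ((u.map k).restrict (u.map_mem_chain α k))
    fun x hx => u.map_mem_chain (α + 1) k x hx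

/-- The Kaplansky invariant `κ_{k,α}(u)`, the dimension of the kernel of the induced map
`U_{k,α} / U_{k,α+1} → U_{k+1,α+1} / U_{k+1,α+2}`. -/
noncomputable def kappa (u : CyclicRep.{u, w} F n) (k : ZMod n) (α : Ordinal.{u}) :
    Cardinal.{u} :=
  Module.rank F (LinearMap.ker (u.layerMap k α))

end CyclicRep

/-!
The invariants are preserved by isomorphisms because the chains are. The converse is a
back-and-forth argument in the manner of Kaplansky and Mackey's proof of Ulm's theorem. The height
of a nonzero vector `x` at the vertex `k` is the largest `α` with `x ∈ U_{k,α}`; it exists because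
`u` is reduced, and it is countable because a chain of subspaces in countable dimension becomes
constant before `ω₁` (`CyclicRep.exists_height`). Everything takes place among partial isomorphisms
that preserve heights and have finite-dimensional domains (`CyclicRep.FinPartialIso`), encoded by
their graphs `Γ k ⊆ U k × V k`, which makes the situation symmetric in `u` and `v`.

The essential step is to adjoin a vector `x` at the vertex `k` to the domain
(`CyclicRep.FinPartialIso.exists_le_mem_fst`). By local nilpotence `u x` may be assumed to lie in
the domain already, and is thus matched with some `z`. As the domain is finite-dimensional, `x` can
be translated by an element of it so as to have maximal height `α` and, if possible, an image of
height at least `α + 2`. One needs `y` of height `α`, maximal on its coset modulo the range, with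
`v y = z` (`CyclicRep.IsPartialIso.exists_counterpart`). If `u x` has height `α + 1`, any preimage
of `z` in `V_{k,α}` will do. Otherwise `x` represents a class in the kernel that defines
`κ_{k,α}(u)`, outside the finite-dimensional subspace coming from the domain. The range gives a
subspace of the same dimension on the side of `v`, which must be proper since `κ_{k,α}(u) =
κ_{k,α}(v)` (`CyclicRep.IsPartialIso.exists_mem_layerKer`); a representative of a class outside it,
corrected by an element of `V_{k,α+1}`, is the required `y`.

The partial isomorphisms whose domain or range contains a given basis vector are therefore cofinal,
and the Rasiowa–Sikorski lemma provides a directed family of them that meets all these countably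
many cofinal sets. The union of its graphs is the graph of an isomorphism.
-/

/-! ### Chains of subspaces -/

/-- Since the traces of a descending chain on a finite-dimensional subspace satisfy the descending
chain condition, one of them lies in all the others. -/
theorem Submodule.exists_inf_le_of_antitone {F E ι : Type*} [Field F] [AddCommGroup E] [Module F E]
    [LinearOrder ι] {C : ι → Submodule F E} (hC : Antitone C) (D : Submodule F E)
    [FiniteDimensional F D] {s : Set ι} (hs : s.Nonempty) :
    ∃ β ∈ s, ∀ γ ∈ s, D ⊓ C β ≤ C γ := by
  obtain ⟨_, ⟨β, hβ, rfl⟩, hmin⟩ := wellFounded_lt.has_min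
    ((fun β => (C β).comap D.subtype) '' s) (hs.image _)
  refine ⟨β, hβ, fun γ hγ x hx => ?_⟩
  rcases le_total γ β with h | h
  · exact hC h hx.2
  · have hle : (C γ).comap D.subtype ≤ (C β).comap D.subtype := Submodule.comap_mono (hC h)
    have heq := eq_of_le_of_not_lt hle (hmin _ ⟨γ, hγ, rfl⟩)
    have hx' : (⟨x, hx.1⟩ : D) ∈ (C β).comap D.subtype := hx.2
    rw [← heq] at hx'
    exact hx'

/-- A nonempty subset of a finite-dimensional subspace has an element of maximal height with
respect to a descending chain of subspaces. -/
theorem Submodule.exists_maximal_height {F E ι : Type*} [Field F] [AddCommGroup E] [Module F E]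
    [LinearOrder ι] {C : ι → Submodule F E} (hC : Antitone C) (D : Submodule F E)
    [FiniteDimensional F D] {Q : Set E} (hQ : Q.Nonempty) (hQD : Q ⊆ D) :
    ∃ q ∈ Q, ∀ q' ∈ Q, ∀ β, q' ∈ C β → q ∈ C β := by
  rcases Set.eq_empty_or_nonempty {β | ∃ q ∈ Q, q ∈ C β} with h | h
  · obtain ⟨q, hq⟩ := hQ
    refine ⟨q, hq, fun q' hq' β hβ => ?_⟩
    have : β ∈ {β | ∃ q ∈ Q, q ∈ C β} := ⟨q', hq', hβ⟩
    simp [h] at this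
  · obtain ⟨β, ⟨q, hq, hqβ⟩, hmin⟩ := Submodule.exists_inf_le_of_antitone hC D h
    exact ⟨q, hq, fun q' hq' γ hγ => hmin γ ⟨q', hq', hγ⟩ ⟨hQD hq, hqβ⟩⟩

theorem Module.exists_countable_basis {F : Type w} {E : Type u} [Field F] [AddCommGroup E]
    [Module F E] (h : Module.rank F E ≤ ℵ₀) :
    ∃ (ι : Type u) (_ : Countable ι), Nonempty (Module.Basis ι F E) := by
  let b := Module.Basis.ofVectorSpace F E
  refine ⟨_, ?_, ⟨b⟩⟩
  rw [← Cardinal.mk_le_aleph0_iff, b.mk_eq_rank'']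
  exact h

/-- Each finite-dimensional subspace sees the chain become constant before `ω₁`, and countably many
of these subspaces exhaust a space of countable dimension. -/
theorem Submodule.exists_stable_lt_omega_one {F : Type w} {κ : Type*} [Countable κ] [Field F]
    {E : κ → Type u} [∀ k, AddCommGroup (E k)] [∀ k, Module F (E k)]
    (hE : ∀ k, Module.rank F (E k) ≤ ℵ₀) {C : ∀ k, Ordinal.{u} → Submodule F (E k)}
    (hC : ∀ k, Antitone (C k)) :
    ∃ α < ω₁, ∀ k, ∀ β < ω₁, C k α ≤ C k β := by
  choose ι hι b using fun k => Module.exists_countable_basis (hE k)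
  have key (p : Σ k, Finset (ι k)) : ∃ β ∈ Set.Iio ω₁, ∀ γ ∈ Set.Iio ω₁,
      Submodule.span F ((b p.1).some '' (p.2 : Set (ι p.1))) ⊓ C p.1 β ≤ C p.1 γ := by
    have := FiniteDimensional.span_of_finite F (p.2.finite_toSet.image (b p.1).some)
    exact Submodule.exists_inf_le_of_antitone (hC p.1) _ ⟨0, Ordinal.omega_pos 1⟩
  choose f hf hfle using key
  refine ⟨⨆ p, f p, Ordinal.iSup_lt_omega_one hf, fun k β hβ x hx => ?_⟩
  let s := ((b k).some.repr x).support
  refine hfle ⟨k, s⟩ β hβ ⟨(b k).some.mem_span_repr_support x, hC k ?_ hx⟩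
  exact Ordinal.le_iSup f ⟨k, s⟩

/-! ### Heights of vectors -/

namespace CyclicRep

variable {F : Type w} [Field F] {n : ℕ}

theorem chain_add_one_le (u : CyclicRep.{u, w} F n) (α : Ordinal.{u}) :
    ∀ k, u.chain (α + 1) k ≤ u.chain α k := by
  induction α using Ordinal.limitRecOn with
  | zero => intro k; simp [chain_zero]
  | add_one α ih =>
    intro k
    obtain ⟨j, rfl⟩ : ∃ j, k = j + 1 := ⟨k - 1, by simp⟩
    rw [chain_add_one, chain_add_one]
    exact Submodule.map_mono (ih j)
  | limit α hα ih =>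
    intro k
    obtain ⟨j, rfl⟩ : ∃ j, k = j + 1 := ⟨k - 1, by simp⟩
    rw [chain_limit u hα (j + 1)]
    refine le_iInf₂ fun β hβ => le_trans ?_ (ih β hβ (j + 1))
    rw [chain_add_one, chain_add_one, chain_limit u hα j]
    exact Submodule.map_mono (iInf₂_le β hβ)

theorem chain_antitone (u : CyclicRep.{u, w} F n) (k : ZMod n) :
    Antitone fun α => u.chain α k := by
  intro β α h
  induction α using Ordinal.limitRecOn with
  | zero => rw [nonpos_iff_eq_zero.1 h]
  | add_one α ih =>
    rcases h.lt_or_eq with h | rfl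
    · exact (u.chain_add_one_le α k).trans (ih (Order.lt_add_one_iff.1 h))
    · exact le_rfl
  | limit α hα ih =>
    rcases h.lt_or_eq with h | rfl
    · simp only [chain_limit u hα k]
      exact iInf₂_le β h
    · exact le_rfl

theorem rank_le_dim (u : CyclicRep.{u, w} F n) (k : ZMod n) : Module.rank F (u.U k) ≤ u.dim := by
  have := Cardinal.le_sum (fun k => Module.rank F (u.U k)) k
  simpa [dim] using this

/-- Over all vertices at once the chain becomes constant before `ω₁`, and a reduced representation
has nothing left there. -/
theorem exists_chain_eq_bot [NeZero n] {u : CyclicRep.{u, w} F n} (hu : u.Reduced)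
    (hd : ∀ k, Module.rank F (u.U k) ≤ ℵ₀) :
    ∃ α : Ordinal.{u}, α < ω₁ ∧ ∀ k, u.chain α k = ⊥ := by
  obtain ⟨α, hα, h⟩ := Submodule.exists_stable_lt_omega_one hd (fun k => u.chain_antitone k)
  refine ⟨α, hα, fun k => ?_⟩
  -- Constancy from `α` to `α + 1` at all vertices propagates to every ordinal.
  have key : ∀ β, ∀ k, u.chain α k ≤ u.chain β k := by
    intro β
    induction β using Ordinal.limitRecOn with
    | zero => intro k; simp [chain_zero]
    | add_one β ih =>
      intro k
      obtain ⟨j, rfl⟩ : ∃ j, k = j + 1 := ⟨k - 1, by simp⟩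
      refine (h (j + 1) (α + 1) ?_).trans ?_
      · exact (Cardinal.isSuccLimit_omega 1).add_one_lt hα
      · rw [chain_add_one, chain_add_one]
        exact Submodule.map_mono (ih j)
    | limit β hβ ih =>
      intro k
      rw [chain_limit u hβ k]
      exact le_iInf₂ fun γ hγ => ih γ hγ k
  rw [eq_bot_iff, ← hu k]
  exact le_iInf fun β => key β k

/-- Every nonzero vector of a reduced representation of countable dimension has a height, and this
height is a countable ordinal. -/
theorem exists_height [NeZero n] {u : CyclicRep.{u, w} F n} (hu : u.Reduced)
    (hd : ∀ k, Module.rank F (u.U k) ≤ ℵ₀) {k : ZMod n} {x : u.U k} (hx : x ≠ 0) :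
    ∃ α : Ordinal.{u}, α < ω₁ ∧ x ∈ u.chain α k ∧ x ∉ u.chain (α + 1) k := by
  obtain ⟨ζ, hζ, hbot⟩ := exists_chain_eq_bot hu hd
  have hxζ : x ∉ u.chain ζ k := by simpa [hbot k] using hx
  obtain ⟨α, hα, hmin⟩ := wellFounded_lt.has_min {β | x ∉ u.chain β k} ⟨ζ, hxζ⟩
  have hmin' : ∀ β < α, x ∈ u.chain β k := fun β hβ => by
    by_contra hc
    exact hmin β hc hβ
  have hαζ : α ≤ ζ := not_lt.1 (hmin ζ hxζ)
  rcases Ordinal.zero_or_succ_or_isSuccLimit α with rfl | ⟨β, rfl⟩ | hlim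
  · exact absurd (by simp [chain_zero] : x ∈ u.chain 0 k) hα
  · exact ⟨β, ((Order.lt_succ β).trans_le hαζ).trans hζ, hmin' β (Order.lt_succ β), hα⟩
  · refine absurd ?_ hα
    rw [chain_limit u hlim]
    simpa using hmin'

/-! ### Local nilpotence at every vertex -/

/-- The vector `x` at the vertex `k` is killed by finitely many consecutive maps. -/
inductive IsNilAt (u : CyclicRep.{u, w} F n) : ∀ k, u.U k → Prop
  | zero (k : ZMod n) : IsNilAt u k 0
  | step (k : ZMod n) (x : u.U k) : IsNilAt u (k + 1) (u.map k x) → IsNilAt u k x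

theorem IsNilAt.of_path {u : CyclicRep.{u, w} F n} (m : ℕ) {a b : ZMod n}
    (h : a + (m : ZMod n) = b) (x : u.U a) (hx : u.IsNilAt b (u.path m h x)) :
    u.IsNilAt a x := by
  induction m generalizing b with
  | zero =>
    obtain rfl : a = b := by simpa using h
    exact hx
  | succ m ih =>
    refine ih rfl ?_
    obtain rfl : a + (m : ZMod n) + 1 = b := by rw [← h]; push_cast; ring
    exact IsNilAt.step _ _ hx

theorem LocallyNilpotent.isNilAt [NeZero n] {u : CyclicRep.{u, w} F n} (hu : u.LocallyNilpotent)
    (k : ZMod n) (x : u.U k) : u.IsNilAt k x := by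
  have h0 : ∀ (i : ℕ) (x : u.U 0), (u.cycle 0 ^ i) x = 0 → u.IsNilAt 0 x := by
    intro i
    induction i with
    | zero =>
      intro x hx
      obtain rfl : x = 0 := by simpa using hx
      exact IsNilAt.zero 0
    | succ i ih =>
      intro x hx
      refine IsNilAt.of_path n (by simp) x (ih _ ?_)
      rw [pow_succ] at hx
      exact hx
  have hk : k + ((-k).val : ZMod n) = 0 := by simp
  obtain ⟨i, hi⟩ := hu (u.path _ hk x)
  exact IsNilAt.of_path _ hk x (h0 i _ hi)

/-! ### Partial isomorphisms and the Kaplansky invariants -/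

/-- The vectors of `U_{k,α}` whose class modulo `U_{k,α+1}` is killed by `layerMap`. -/
noncomputable def layerKer (u : CyclicRep.{u, w} F n) (k : ZMod n) (α : Ordinal.{u}) :
    Submodule F (u.U k) :=
  u.chain α k ⊓ (u.chain (α + 1 + 1) (k + 1)).comap (u.map k)

/-- The class of a vector of `layerKer` in the kernel of `layerMap`. -/
noncomputable def toKerLayerMap (u : CyclicRep.{u, w} F n) (k : ZMod n) (α : Ordinal.{u}) :
    u.layerKer k α →ₗ[F] LinearMap.ker (u.layerMap k α) :=
  LinearMap.codRestrict _
    (Submodule.mkQ _ ∘ₗ Submodule.inclusion (inf_le_left : u.layerKer k α ≤ u.chain α k)) <| by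
      intro x
      rw [LinearMap.mem_ker]
      exact (Submodule.Quotient.mk_eq_zero _).2 x.2.2

theorem toKerLayerMap_eq_zero_iff (u : CyclicRep.{u, w} F n) (k : ZMod n) (α : Ordinal.{u})
    (x : u.layerKer k α) : u.toKerLayerMap k α x = 0 ↔ (x : u.U k) ∈ u.chain (α + 1) k := by
  rw [← Subtype.coe_inj]
  exact Submodule.Quotient.mk_eq_zero _

theorem toKerLayerMap_surjective (u : CyclicRep.{u, w} F n) (k : ZMod n) (α : Ordinal.{u}) :
    Function.Surjective (u.toKerLayerMap k α) := by
  rintro ⟨y, hy⟩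
  obtain ⟨x, rfl⟩ := Submodule.mkQ_surjective _ y
  rw [LinearMap.mem_ker] at hy
  refine ⟨⟨x, x.2, ?_⟩, rfl⟩
  exact (Submodule.Quotient.mk_eq_zero ((u.chain (α + 1 + 1) (k + 1)).submoduleOf _)).1 hy

/-- A partial isomorphism from `u` to `v`, encoded by the graphs `Γ k` of its components: it
commutes with the maps of the two representations and preserves heights. For reduced
representations the last condition forces the graphs to be those of injective maps. -/
structure IsPartialIso (u v : CyclicRep.{u, w} F n)
    (Γ : ∀ k, Submodule F (u.U k × v.U k)) : Prop where
  map_mem : ∀ k, ∀ p ∈ Γ k, (u.map k p.1, v.map k p.2) ∈ Γ (k + 1)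
  mem_chain_iff : ∀ k, ∀ p ∈ Γ k, ∀ α : Ordinal.{u}, p.1 ∈ u.chain α k ↔ p.2 ∈ v.chain α k

/-- The pairs of a graph both of whose components lie in `layerKer`. -/
noncomputable def layerGraph (u v : CyclicRep.{u, w} F n) (Γ : ∀ k, Submodule F (u.U k × v.U k))
    (k : ZMod n) (α : Ordinal.{u}) : Submodule F (u.U k × v.U k) :=
  Γ k ⊓ (u.layerKer k α).prod (v.layerKer k α)

/-- The class of the first component, as an element of the kernel defining `u.kappa k α`. -/
noncomputable def layerFst (u v : CyclicRep.{u, w} F n) (Γ : ∀ k, Submodule F (u.U k × v.U k))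
    (k : ZMod n) (α : Ordinal.{u}) : layerGraph u v Γ k α →ₗ[F] LinearMap.ker (u.layerMap k α) :=
  u.toKerLayerMap k α ∘ₗ (LinearMap.fst F _ _).restrict fun _ hp => hp.2.1

/-- The class of the second component, as an element of the kernel defining `v.kappa k α`. -/
noncomputable def layerSnd (u v : CyclicRep.{u, w} F n) (Γ : ∀ k, Submodule F (u.U k × v.U k))
    (k : ZMod n) (α : Ordinal.{u}) : layerGraph u v Γ k α →ₗ[F] LinearMap.ker (v.layerMap k α) :=
  v.toKerLayerMap k α ∘ₗ (LinearMap.snd F _ _).restrict fun _ hp => hp.2.2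

variable {u v : CyclicRep.{u, w} F n} {Γ : ∀ k, Submodule F (u.U k × v.U k)}

theorem IsPartialIso.mem_layerKer_iff (hΓ : IsPartialIso u v Γ) {k : ZMod n} {α : Ordinal.{u}}
    {p : u.U k × v.U k} (hp : p ∈ Γ k) : p.1 ∈ u.layerKer k α ↔ p.2 ∈ v.layerKer k α :=
  and_congr (hΓ.mem_chain_iff k p hp α) (hΓ.mem_chain_iff _ _ (hΓ.map_mem k p hp) _)

theorem IsPartialIso.ker_layerFst (hΓ : IsPartialIso u v Γ) (k : ZMod n) (α : Ordinal.{u}) :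
    LinearMap.ker (layerFst u v Γ k α) = LinearMap.ker (layerSnd u v Γ k α) := by
  ext p
  rw [LinearMap.mem_ker, LinearMap.mem_ker]
  exact (u.toKerLayerMap_eq_zero_iff k α ⟨p.1.1, p.2.2.1⟩).trans
    ((hΓ.mem_chain_iff k p p.2.1 _).trans
      (v.toKerLayerMap_eq_zero_iff k α ⟨p.1.2, p.2.2.2⟩).symm)

/-- The two projections of a partial isomorphism cut out subspaces of the same dimension in the
spaces that define the Kaplansky invariants. -/
theorem IsPartialIso.rank_range_layer (hΓ : IsPartialIso u v Γ) (k : ZMod n) (α : Ordinal.{u}) :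
    Module.rank F (LinearMap.range (layerFst u v Γ k α)) =
      Module.rank F (LinearMap.range (layerSnd u v Γ k α)) :=
  ((LinearMap.quotKerEquivRange _).symm.trans
    ((Submodule.quotEquivOfEq _ _ (hΓ.ker_layerFst k α)).trans
      (LinearMap.quotKerEquivRange _))).rank_eq

/-- The graph of an isomorphism of representations. -/
theorem Iso.isPartialIso (φ : Iso u v) :
    IsPartialIso u v fun k => LinearMap.graph (φ.φ k : u.U k →ₗ[F] v.U k) where
  map_mem := by
    rintro k ⟨x, y⟩ h
    obtain rfl : y = φ.φ k x := h
    exact φ.comm k x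
  mem_chain_iff := by
    rintro k ⟨x, y⟩ h α
    obtain rfl : y = φ.φ k x := h
    induction α using Ordinal.limitRecOn generalizing k with
    | zero => simp [chain_zero]
    | add_one α ih =>
      obtain ⟨j, rfl⟩ : ∃ j, k = j + 1 := ⟨k - 1, by simp⟩
      rw [chain_add_one, chain_add_one]
      constructor
      · rintro ⟨z, hz, hzx⟩
        exact ⟨φ.φ j z, (ih j z).1 hz, by simpa [hzx] using φ.comm j z⟩
      · rintro ⟨z, hz, hzx⟩
        obtain ⟨z, rfl⟩ := (φ.φ j).surjective z
        exact ⟨z, (ih j z).2 hz, (φ.φ (j + 1)).injective ((φ.comm j z).symm.trans hzx)⟩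
    | limit α hα ih =>
      rw [chain_limit u hα, chain_limit v hα]
      simp only [Submodule.mem_iInf]
      exact forall₂_congr fun β hβ => ih β hβ k x

theorem Iso.kappa_eq (φ : Iso u v) (k : ZMod n) (α : Ordinal.{u}) :
    u.kappa k α = v.kappa k α := by
  have hφ := φ.isPartialIso
  have h := hφ.rank_range_layer k α
  rw [LinearMap.range_eq_top.2, LinearMap.range_eq_top.2, rank_top, rank_top] at h
  · exact h
  · intro y
    obtain ⟨⟨x, hx⟩, rfl⟩ := v.toKerLayerMap_surjective k α y
    obtain ⟨x, rfl⟩ := (φ.φ k).surjective x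
    have hmem : (x, φ.φ k x) ∈ LinearMap.graph (φ.φ k : u.U k →ₗ[F] v.U k) := rfl
    exact ⟨⟨(x, φ.φ k x), hmem, (hφ.mem_layerKer_iff hmem).2 hx, hx⟩, rfl⟩
  · intro y
    obtain ⟨⟨x, hx⟩, rfl⟩ := u.toKerLayerMap_surjective k α y
    have hmem : (x, φ.φ k x) ∈ LinearMap.graph (φ.φ k : u.U k →ₗ[F] v.U k) := rfl
    exact ⟨⟨(x, φ.φ k x), hmem, hx, (hφ.mem_layerKer_iff hmem).1 hx⟩, rfl⟩

/-- If the domain of a finite-dimensional partial isomorphism does not represent every class of the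
kernel that defines `u.kappa k α`, then, the invariants being equal, its range does not represent
every class of the kernel that defines `v.kappa k α`. -/
theorem IsPartialIso.exists_mem_layerKer (hΓ : IsPartialIso u v Γ) {k : ZMod n} {α : Ordinal.{u}}
    [FiniteDimensional F (Γ k)] (hκ : u.kappa k α = v.kappa k α) {x : u.U k}
    (hx : x ∈ u.layerKer k α) (hxΓ : ∀ p ∈ Γ k, x + p.1 ∉ u.chain (α + 1) k) :
    ∃ y ∈ v.layerKer k α, ∀ p ∈ Γ k, y + p.2 ∉ v.chain (α + 1) k := by
  by_contra! hcon
  have hfin : FiniteDimensional F (layerGraph u v Γ k α) :=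
    Submodule.finiteDimensional_of_le inf_le_left
  have hsurj : LinearMap.range (layerSnd u v Γ k α) = ⊤ := by
    rw [LinearMap.range_eq_top]
    intro z
    obtain ⟨⟨y, hy⟩, rfl⟩ := v.toKerLayerMap_surjective k α z
    obtain ⟨p, hp, hyp⟩ := hcon y hy
    have hyp' : v.map k (y + p.2) ∈ v.chain (α + 1 + 1) (k + 1) := v.map_mem_chain _ _ _ hyp
    have hp2 : p.2 ∈ v.layerKer k α := by
      have : y + p.2 ∈ v.layerKer k α := ⟨v.chain_add_one_le α k hyp, hyp'⟩
      simpa using sub_mem this hy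
    have hp1 := (hΓ.mem_layerKer_iff hp).2 hp2
    have hsum : v.toKerLayerMap k α ⟨y, hy⟩ + v.toKerLayerMap k α ⟨p.2, hp2⟩ = 0 := by
      rw [← map_add, toKerLayerMap_eq_zero_iff]
      exact hyp
    exact ⟨-⟨p, hp, hp1, hp2⟩, (map_neg _ _).trans (eq_neg_of_add_eq_zero_left hsum).symm⟩
  -- The classes coming from `Γ k` exhaust the kernel on the side of `v`. Those on the
  -- side of `u` have the same finite rank, hence exhaust the kernel there too, with the class of `x`.
  have hrank := hΓ.rank_range_layer k α
  rw [hsurj, rank_top] at hrank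
  have hfinv : Module.rank F (LinearMap.range (layerFst u v Γ k α)) < ℵ₀ :=
    Module.rank_lt_aleph0 F _
  have hfinu : FiniteDimensional F (LinearMap.ker (u.layerMap k α)) := by
    rw [FiniteDimensional, ← Module.rank_lt_aleph0_iff]
    exact (hκ.trans hrank.symm).trans_lt hfinv
  have htop : LinearMap.range (layerFst u v Γ k α) = ⊤ := by
    refine Submodule.eq_top_of_finrank_eq ?_
    exact congrArg Cardinal.toNat (hrank.trans hκ.symm)
  obtain ⟨⟨p, hp⟩, hpx⟩ := LinearMap.range_eq_top.1 htop (u.toKerLayerMap k α ⟨x, hx⟩)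
  refine hxΓ (-p) (neg_mem hp.1) ?_
  change u.toKerLayerMap k α ⟨p.1, hp.2.1⟩ = _ at hpx
  rw [eq_comm, ← sub_eq_zero, ← map_sub, toKerLayerMap_eq_zero_iff] at hpx
  simpa [sub_eq_add_neg] using hpx

/-! ### Extending a partial isomorphism -/

/-- A vector `x` of height `α`, maximal among the heights on its coset modulo the domain, has a
counterpart `y` on the other side. In the first case `u x` has height `α + 1`, however `x` is
translated within the domain at height `α`, and any preimage of the vector matched with `u x` will
do; in the second case `u x` has larger height and `y` is found through the Kaplansky invariant. -/
theorem IsPartialIso.exists_counterpart (hΓ : IsPartialIso u v Γ) {k : ZMod n} {α : Ordinal.{u}}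
    [FiniteDimensional F (Γ k)] (hκ : u.kappa k α = v.kappa k α) {x : u.U k}
    (hx : x ∈ u.chain α k) (hmax : ∀ p ∈ Γ k, x + p.1 ∉ u.chain (α + 1) k)
    (hmap : (∀ p ∈ Γ k, p.1 ∈ u.chain α k →
        u.map k (x + p.1) ∉ u.chain (α + 1 + 1) (k + 1)) ∨
      u.map k x ∈ u.chain (α + 1 + 1) (k + 1))
    {z : v.U (k + 1)} (hz : (u.map k x, z) ∈ Γ (k + 1)) :
    ∃ y ∈ v.chain α k, v.map k y = z ∧ ∀ p ∈ Γ k, y + p.2 ∉ v.chain (α + 1) k := by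
  rcases hmap with hmap | hmap
  · have hzα : z ∈ v.chain (α + 1) (k + 1) :=
      (hΓ.mem_chain_iff _ _ hz _).1 (u.map_mem_chain _ _ _ hx)
    rw [chain_add_one] at hzα
    obtain ⟨y, hy, rfl⟩ := hzα
    refine ⟨y, hy, rfl, fun p hp hyp => ?_⟩
    have hp2 : p.2 ∈ v.chain α k := by
      simpa using sub_mem (v.chain_add_one_le α k hyp) hy
    refine hmap p hp ((hΓ.mem_chain_iff k p hp α).2 hp2) ?_
    have hsum := add_mem hz (hΓ.map_mem k p hp)
    rw [map_add]
    refine (hΓ.mem_chain_iff _ _ hsum _).2 ?_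
    have := v.map_mem_chain _ _ _ hyp
    rwa [map_add] at this
  · obtain ⟨y, ⟨hy, hy'⟩, hyΓ⟩ := hΓ.exists_mem_layerKer hκ ⟨hx, hmap⟩ hmax
    have hdiff : v.map k y - z ∈ v.chain (α + 1 + 1) (k + 1) :=
      sub_mem hy' ((hΓ.mem_chain_iff _ _ hz _).1 hmap)
    rw [chain_add_one] at hdiff
    obtain ⟨y', hy', hyz⟩ := hdiff
    refine ⟨y - y', sub_mem hy (v.chain_add_one_le α k hy'), by rw [map_sub, hyz]; abel,
      fun p hp hyp => hyΓ p hp ?_⟩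
    have := add_mem hyp hy'
    rwa [show y - y' + p.2 + y' = y + p.2 by abel] at this

/-- Two vectors of height `α`, both maximal on their cosets, have translates of equal heights. -/
theorem IsPartialIso.add_mem_chain_iff (hΓ : IsPartialIso u v Γ) {k : ZMod n} {α : Ordinal.{u}}
    {x : u.U k} (hx : x ∈ u.chain α k) (hmax : ∀ p ∈ Γ k, x + p.1 ∉ u.chain (α + 1) k)
    {y : v.U k} (hy : y ∈ v.chain α k) (hmay : ∀ p ∈ Γ k, y + p.2 ∉ v.chain (α + 1) k)
    (p : u.U k × v.U k) (hp : p ∈ Γ k) (β : Ordinal.{u}) :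
    x + p.1 ∈ u.chain β k ↔ y + p.2 ∈ v.chain β k := by
  rcases le_or_gt β α with h | h
  · rw [Submodule.add_mem_iff_right _ (u.chain_antitone k h hx),
      Submodule.add_mem_iff_right _ (v.chain_antitone k h hy)]
    exact hΓ.mem_chain_iff k p hp β
  · have h' := Order.add_one_le_of_lt h
    exact iff_of_false (fun hc => hmax p hp (u.chain_antitone k h' hc))
      (fun hc => hmay p hp (v.chain_antitone k h' hc))

theorem IsPartialIso.update (hΓ : IsPartialIso u v Γ) {k : ZMod n} {x : u.U k} {y : v.U k}
    (hmap : (u.map k x, v.map k y) ∈ Γ (k + 1))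
    (hxy : ∀ p ∈ Γ k, ∀ β : Ordinal.{u}, x + p.1 ∈ u.chain β k ↔ y + p.2 ∈ v.chain β k) :
    IsPartialIso u v (Function.update Γ k (Γ k ⊔ Submodule.span F {(x, y)})) := by
  have hle : ∀ j, Γ j ≤ Function.update Γ k (Γ k ⊔ Submodule.span F {(x, y)}) j := by
    intro j
    rcases eq_or_ne j k with rfl | hj
    · simp
    · simp [hj]
  constructor
  · intro j p hp
    apply hle
    rcases eq_or_ne j k with rfl | hj
    · rw [Function.update_self, Submodule.mem_sup] at hp
      obtain ⟨q, hq, r, hr, rfl⟩ := hp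
      obtain ⟨c, rfl⟩ := Submodule.mem_span_singleton.1 hr
      have := add_mem (hΓ.map_mem j q hq) (Submodule.smul_mem _ c hmap)
      simpa using this
    · rw [Function.update_of_ne hj] at hp
      exact hΓ.map_mem j p hp
  · intro j p hp β
    rcases eq_or_ne j k with rfl | hj
    · rw [Function.update_self, Submodule.mem_sup] at hp
      obtain ⟨q, hq, r, hr, rfl⟩ := hp
      obtain ⟨c, rfl⟩ := Submodule.mem_span_singleton.1 hr
      rcases eq_or_ne c 0 with rfl | hc
      · simpa using hΓ.mem_chain_iff j q hq β
      · have := hxy (c⁻¹ • q) (Submodule.smul_mem _ _ hq) β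
        rw [← Submodule.smul_mem_iff _ hc, ← Submodule.smul_mem_iff (v.chain β j) hc] at this
        simpa [smul_add, smul_smul, hc, add_comm] using this
    · rw [Function.update_of_ne hj] at hp
      exact hΓ.mem_chain_iff j p hp β

variable (u v) in
/-- The finite-dimensional partial isomorphisms from `u` to `v`, ordered by extension. -/
abbrev FinPartialIso : Type u :=
  {Γ : ∀ k, Submodule F (u.U k × v.U k) //
    IsPartialIso u v Γ ∧ ∀ k, FiniteDimensional F (Γ k)}

/-- Any vector can be put into the domain of a finite-dimensional partial isomorphism. By local
nilpotence its image may be assumed to lie there already. -/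
theorem FinPartialIso.exists_le_mem_fst [NeZero n] (hu : u.Reduced)
    (hd : ∀ k, Module.rank F (u.U k) ≤ ℵ₀)
    (hκ : ∀ (k : ZMod n) (α : Ordinal.{u}), α < ω₁ → u.kappa k α = v.kappa k α)
    {k : ZMod n} {x : u.U k} (hx : u.IsNilAt k x) (Γ : FinPartialIso u v) :
    ∃ Γ' : FinPartialIso u v, Γ ≤ Γ' ∧ ∃ y, (x, y) ∈ Γ'.1 k := by
  induction hx with
  | zero k => exact ⟨Γ, le_rfl, 0, zero_mem _⟩
  | step k x _ ih =>
    obtain ⟨Γ₁, hΓ₁, z, hz⟩ := ih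
    suffices h : ∃ Γ' : FinPartialIso u v, Γ₁ ≤ Γ' ∧ ∃ y, (x, y) ∈ Γ'.1 k by
      obtain ⟨Γ', h, h'⟩ := h
      exact ⟨Γ', hΓ₁.trans h, h'⟩
    by_cases hdom : ∃ y, (x, y) ∈ Γ₁.1 k
    · exact ⟨Γ₁, le_rfl, hdom⟩
    obtain ⟨Γ₁, hΓ, hfin⟩ := Γ₁
    dsimp only at hz hdom
    have := hfin k
    -- A translate `x + p.1` of maximal height.
    obtain ⟨_, ⟨p, hp, rfl⟩, hpmax⟩ := Submodule.exists_maximal_height (u.chain_antitone k)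
      ((Γ₁ k).map (LinearMap.fst F _ _) ⊔ Submodule.span F {x})
      (Q := (fun p : u.U k × v.U k => x + p.1) '' (Γ₁ k)) ⟨_, 0, zero_mem _, rfl⟩ <| by
        rintro _ ⟨p, hp, rfl⟩
        exact add_mem (Submodule.mem_sup_right (Submodule.mem_span_singleton_self x))
          (Submodule.mem_sup_left ⟨p, hp, rfl⟩)
    have hne : x + p.1 ≠ 0 := by
      intro h0
      refine hdom ⟨-p.2, ?_⟩
      rw [eq_neg_of_add_eq_zero_left h0]
      exact neg_mem hp
    obtain ⟨α, hα, hxα, hxα'⟩ := exists_height hu hd hne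
    have hmax : ∀ q ∈ Γ₁ k, x + q.1 ∉ u.chain (α + 1) k := fun q hq hc =>
      hxα' (hpmax _ ⟨q, hq, rfl⟩ _ hc)
    -- If some translate of the same height has an image of height at least `α + 2`, it is chosen.
    obtain ⟨q, hq, hxq, hmap⟩ : ∃ q ∈ Γ₁ k, x + q.1 ∈ u.chain α k ∧
        ((∀ r ∈ Γ₁ k, r.1 ∈ u.chain α k →
          u.map k (x + q.1 + r.1) ∉ u.chain (α + 1 + 1) (k + 1)) ∨
        u.map k (x + q.1) ∈ u.chain (α + 1 + 1) (k + 1)) := by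
      by_cases h : ∀ r ∈ Γ₁ k, r.1 ∈ u.chain α k →
          u.map k (x + p.1 + r.1) ∉ u.chain (α + 1 + 1) (k + 1)
      · exact ⟨p, hp, hxα, .inl h⟩
      · push Not at h
        obtain ⟨r, hr, hrα, hmap⟩ := h
        refine ⟨p + r, add_mem hp hr, ?_, .inr ?_⟩
        · simpa [add_assoc] using add_mem hxα hrα
        · simpa [add_assoc] using hmap
    have hmax' : ∀ r ∈ Γ₁ k, x + q.1 + r.1 ∉ u.chain (α + 1) k := fun r hr => by
      simpa [add_assoc] using hmax (q + r) (add_mem hq hr)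
    have hz' : (u.map k (x + q.1), z + v.map k q.2) ∈ Γ₁ (k + 1) := by
      simpa using add_mem hz (hΓ.map_mem k q hq)
    obtain ⟨y, hy, hyz, hmay⟩ := hΓ.exists_counterpart (hκ k α hα) hxq hmax' hmap hz'
    rw [← hyz] at hz'
    have hle : Γ₁ ≤ Function.update Γ₁ k (Γ₁ k ⊔ Submodule.span F {(x + q.1, y)}) := by
      rw [le_update_iff]
      exact ⟨le_sup_left, fun _ _ => le_rfl⟩
    refine ⟨⟨_, hΓ.update hz' (hΓ.add_mem_chain_iff hxq hmax' hy hmay), fun j => ?_⟩, hle,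
      y - q.2, ?_⟩
    · have := hfin j
      rcases eq_or_ne j k with rfl | hj
      · rw [Function.update_self]
        infer_instance
      · rwa [Function.update_of_ne hj]
    · have h1 := hle k hq
      have h2 : (x + q.1, y) ∈
          Function.update Γ₁ k (Γ₁ k ⊔ Submodule.span F {(x + q.1, y)}) k := by
        rw [Function.update_self]
        exact Submodule.mem_sup_right (Submodule.mem_span_singleton_self _)
      have h3 := sub_mem h2 h1
      have he : (x + q.1, y) - q = (x, y - q.2) := by ext <;> simp
      rwa [he] at h3

/-- Exchanging the two sides of a partial isomorphism. -/
def FinPartialIso.swap (Γ : FinPartialIso u v) : FinPartialIso v u :=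
  ⟨fun k => (Γ.1 k).map (LinearEquiv.prodComm F (u.U k) (v.U k)).toLinearMap,
    { map_mem := by
        rintro k _ ⟨p, hp, rfl⟩
        exact ⟨_, Γ.2.1.map_mem k p hp, rfl⟩
      mem_chain_iff := by
        rintro k _ ⟨p, hp, rfl⟩ α
        exact (Γ.2.1.mem_chain_iff k p hp α).symm },
    fun k => by
      have := Γ.2.2 k
      infer_instance⟩

theorem FinPartialIso.mem_swap {Γ : FinPartialIso u v} {k : ZMod n} {x : u.U k} {y : v.U k} :
    (y, x) ∈ Γ.swap.1 k ↔ (x, y) ∈ Γ.1 k := by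
  constructor
  · rintro ⟨⟨a, b⟩, hp, h⟩
    obtain ⟨rfl, rfl⟩ : b = y ∧ a = x := by simpa using h
    exact hp
  · exact fun h => ⟨(x, y), h, rfl⟩

theorem FinPartialIso.exists_le_mem_snd [NeZero n] (hv : v.Reduced)
    (hd : ∀ k, Module.rank F (v.U k) ≤ ℵ₀)
    (hκ : ∀ (k : ZMod n) (α : Ordinal.{u}), α < ω₁ → u.kappa k α = v.kappa k α)
    {k : ZMod n} {y : v.U k} (hy : v.IsNilAt k y) (Γ : FinPartialIso u v) :
    ∃ Γ' : FinPartialIso u v, Γ ≤ Γ' ∧ ∃ x, (x, y) ∈ Γ'.1 k := by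
  obtain ⟨Γ', hle, x, hx⟩ :=
    exists_le_mem_fst hv hd (fun k α hα => (hκ k α hα).symm) hy Γ.swap
  refine ⟨Γ'.swap, ?_, x, mem_swap.2 hx⟩
  rintro j ⟨a, b⟩ hab
  exact mem_swap.2 (hle j (mem_swap.2 hab))

/-! ### Back and forth -/

theorem Reduced.eq_zero_iff (hu : u.Reduced) {k : ZMod n} {x : u.U k} :
    x = 0 ↔ ∀ α : Ordinal.{u}, x ∈ u.chain α k := by
  rw [← Submodule.mem_iInf, hu k, Submodule.mem_bot]

/-- A partial isomorphism that is everywhere defined and onto is the graph of an isomorphism. -/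
theorem IsPartialIso.nonempty_iso (hu : u.Reduced) (hv : v.Reduced) (hΓ : IsPartialIso u v Γ)
    (hfst : ∀ k x, ∃ y, (x, y) ∈ Γ k) (hsnd : ∀ k y, ∃ x, (x, y) ∈ Γ k) :
    Nonempty (Iso u v) := by
  have hzero : ∀ k, ∀ p ∈ Γ k, p.1 = 0 ↔ p.2 = 0 := fun k p hp => by
    rw [hu.eq_zero_iff, hv.eq_zero_iff]
    exact forall_congr' (hΓ.mem_chain_iff k p hp)
  have h1 : ∀ k, Function.Bijective (LinearMap.fst F (u.U k) (v.U k) ∘ₗ (Γ k).subtype) := by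
    refine fun k => ⟨(injective_iff_map_eq_zero _).2 fun p hp => ?_, fun x => ?_⟩
    · exact Subtype.ext (Prod.ext hp ((hzero k p p.2).1 hp))
    · obtain ⟨y, hy⟩ := hfst k x
      exact ⟨⟨_, hy⟩, rfl⟩
  have h2 : ∀ k, Function.Bijective (LinearMap.snd F (u.U k) (v.U k) ∘ₗ (Γ k).subtype) := by
    refine fun k => ⟨(injective_iff_map_eq_zero _).2 fun p hp => ?_, fun y => ?_⟩
    · exact Subtype.ext (Prod.ext ((hzero k p p.2).2 hp) hp)
    · obtain ⟨x, hx⟩ := hsnd k y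
      exact ⟨⟨_, hx⟩, rfl⟩
  let φ : ∀ k, u.U k ≃ₗ[F] v.U k := fun k =>
    (LinearEquiv.ofBijective _ (h1 k)).symm.trans (LinearEquiv.ofBijective _ (h2 k))
  have hφ : ∀ k, ∀ p ∈ Γ k, φ k p.1 = p.2 := fun k p hp => by
    have : (LinearEquiv.ofBijective _ (h1 k)).symm p.1 = ⟨p, hp⟩ :=
      (LinearEquiv.symm_apply_eq _).2 rfl
    exact congrArg (LinearEquiv.ofBijective _ (h2 k)) this
  refine ⟨⟨φ, fun k x => ?_⟩⟩
  obtain ⟨y, hy⟩ := hfst k x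
  rw [hφ k _ hy, hφ (k + 1) _ (hΓ.map_mem k _ hy)]

/-- The supremum of an ideal of finite-dimensional partial isomorphisms. -/
def idealSup (I : Order.Ideal (FinPartialIso u v)) (k : ZMod n) : Submodule F (u.U k × v.U k) :=
  ⨆ Γ : I, Γ.1.1 k

theorem mem_idealSup {I : Order.Ideal (FinPartialIso u v)} {k : ZMod n} {p : u.U k × v.U k} :
    p ∈ idealSup I k ↔ ∃ Γ ∈ I, p ∈ Γ.1 k := by
  have : Nonempty I := I.nonempty.to_subtype
  rw [idealSup, Submodule.mem_iSup_of_directed]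
  · simp
  · rintro ⟨Γ₁, h₁⟩ ⟨Γ₂, h₂⟩
    obtain ⟨Γ₃, h₃, h₁₃, h₂₃⟩ := I.directed _ h₁ _ h₂
    exact ⟨⟨Γ₃, h₃⟩, h₁₃ k, h₂₃ k⟩

theorem isPartialIso_idealSup (I : Order.Ideal (FinPartialIso u v)) :
    IsPartialIso u v (idealSup I) where
  map_mem k p hp := by
    obtain ⟨Γ, hΓ, hp⟩ := mem_idealSup.1 hp
    exact mem_idealSup.2 ⟨Γ, hΓ, Γ.2.1.map_mem k p hp⟩
  mem_chain_iff k p hp := by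
    obtain ⟨Γ, -, hp⟩ := mem_idealSup.1 hp
    exact Γ.2.1.mem_chain_iff k p hp

/-- The zero partial isomorphism. -/
instance : Nonempty (FinPartialIso u v) :=
  ⟨⟨fun _ => ⊥,
    { map_mem := by
        rintro k p rfl
        simp
      mem_chain_iff := by
        rintro k p rfl α
        simp },
    fun _ => inferInstance⟩⟩

theorem nonempty_iso_of_kappa_eq [NeZero n] (hu : u.LocallyNilpotent) (hv : v.LocallyNilpotent)
    (hu' : u.Reduced) (hv' : v.Reduced) (hdu : ∀ k, Module.rank F (u.U k) ≤ ℵ₀)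
    (hdv : ∀ k, Module.rank F (v.U k) ≤ ℵ₀)
    (hκ : ∀ (k : ZMod n) (α : Ordinal.{u}), α < ω₁ → u.kappa k α = v.kappa k α) :
    Nonempty (Iso u v) := by
  choose ι _ b using fun k => Module.exists_countable_basis (hdu k)
  choose ι' _ b' using fun k => Module.exists_countable_basis (hdv k)
  -- One cofinal set for each basis vector that has to enter the domain or the range.
  let 𝒟 : ((Σ k, ι k) ⊕ (Σ k, ι' k)) → Order.Cofinal (FinPartialIso u v) := Sum.elim
    (fun i => ⟨{Γ | ∃ y, ((b i.1).some i.2, y) ∈ Γ.1 i.1}, fun Γ => by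
      obtain ⟨Γ', hle, h⟩ := Γ.exists_le_mem_fst hu' hdu hκ (hu.isNilAt i.1 ((b i.1).some i.2))
      exact ⟨Γ', h, hle⟩⟩)
    (fun i => ⟨{Γ | ∃ x, (x, (b' i.1).some i.2) ∈ Γ.1 i.1}, fun Γ => by
      obtain ⟨Γ', hle, h⟩ := Γ.exists_le_mem_snd hv' hdv hκ (hv.isNilAt i.1 ((b' i.1).some i.2))
      exact ⟨Γ', h, hle⟩⟩)
  have := Encodable.ofCountable ((Σ k, ι k) ⊕ (Σ k, ι' k))
  let I := Order.idealOfCofinals (Classical.arbitrary _) 𝒟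
  refine (isPartialIso_idealSup I).nonempty_iso hu' hv' (fun k x => ?_) (fun k y => ?_)
  · have htop : (idealSup I k).map (LinearMap.fst F _ _) = ⊤ := by
      rw [eq_top_iff, ← (b k).some.span_eq, Submodule.span_le]
      rintro _ ⟨i, rfl⟩
      obtain ⟨Γ, ⟨y, hy⟩, hΓ⟩ :=
        Order.cofinal_meets_idealOfCofinals (Classical.arbitrary _) 𝒟 (.inl ⟨k, i⟩)
      exact ⟨_, mem_idealSup.2 ⟨Γ, hΓ, hy⟩, rfl⟩
    obtain ⟨p, hp, rfl⟩ := htop.ge (Submodule.mem_top (x := x))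
    exact ⟨p.2, hp⟩
  · have htop : (idealSup I k).map (LinearMap.snd F _ _) = ⊤ := by
      rw [eq_top_iff, ← (b' k).some.span_eq, Submodule.span_le]
      rintro _ ⟨i, rfl⟩
      obtain ⟨Γ, ⟨x, hx⟩, hΓ⟩ :=
        Order.cofinal_meets_idealOfCofinals (Classical.arbitrary _) 𝒟 (.inr ⟨k, i⟩)
      exact ⟨_, mem_idealSup.2 ⟨Γ, hΓ, hx⟩, rfl⟩
    obtain ⟨p, hp, rfl⟩ := htop.ge (Submodule.mem_top (x := y))
    exact ⟨p.1, hp⟩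

end CyclicRep

theorem mainTheorem2 {F : Type w} [Field F] {n : ℕ} [NeZero n] (u v : CyclicRep.{u, w} F n)
    (hu : u.LocallyNilpotent) (hv : v.LocallyNilpotent)
    (hu' : u.Reduced) (hv' : v.Reduced)
    (hdu : u.dim ≤ ℵ₀) (hdv : v.dim ≤ ℵ₀) :
    Nonempty (CyclicRep.Iso u v) ↔
      ∀ (k : ZMod n) (α : Ordinal.{u}), α < ω₁ → u.kappa k α = v.kappa k α :=
  ⟨fun ⟨φ⟩ k α _ => φ.kappa_eq k α,
    CyclicRep.nonempty_iso_of_kappa_eq hu hv hu' hv'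
      (fun k => (u.rank_le_dim k).trans hdu) fun k => (v.rank_le_dim k).trans hdv⟩
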